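/- Let $G$ be a finite simple graph with vertex set $V$, let $K$ be a field, let $R=K[x_v : v\in V]$, and let $I(G)\subseteq R$ be the edge ideal of $G$, i.e. the ideal generated by the monomials $x_vx_w$ for all edges $\{v,w\}$ of $G$ (with $I(G)=(0)$ if $G$ has no edges). Let $\operatorname{ara} I(G)$ be the arithmetical rank of $I(G)$, i.e. the minimum number of elements of $R$ that generate an ideal whose radical is $I(G)$, let $\operatorname{bight} I(G)$ be the big height of $I(G)$, i.e. the maximum height of a minimal prime of $I(G)$, and let $\operatorname{pd} R/I(G)$ be the projective dimension of the $R$-module $R/I(G)$. Then: 1. $\operatorname{bight} I(G)$ equals the largest cardinality of a (with respect to inclusion) minimal vertex cover of $G$. 2. If any two distinct cycles of $G$ (regarded as subgraphs) have no vertex in common and $n$ is the number of cycles of $G$, then $$\operatorname{ara} I(G)\le \operatorname{bight} I(G)+n .$$ 3. In particular, if $G$ has no cycles (i.e. $G$ is a forest), then $$\operatorname{ara} I(G)=\operatorname{bight} I(G)=\operatorname{pd} R/I(G).$$ -/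

import Mathlib

open MvPolynomial

/-- The edge ideal of a graph `G` over `K`: the ideal of the polynomial ring `K[x_v : v ∈ V]`
generated by the monomials `x_v x_w` for the edges `{v, w}` of `G` (the zero ideal when `G` has
no edges). -/
noncomputable def SimpleGraph.edgeIdeal {V : Type*} (G : SimpleGraph V) (K : Type*) [Field K] :
    Ideal (MvPolynomial V K) :=
  Ideal.span {f | ∃ v w : V, G.Adj v w ∧ f = X v * X w}

/-- The cycles of a graph, regarded as subgraphs: two closed walks that differ only in their
starting point or in their orientation give the same cycle. -/
def SimpleGraph.cycleSubgraphs {V : Type*} (G : SimpleGraph V) : Set G.Subgraph :=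
  {H | ∃ (v : V) (p : G.Walk v v), p.IsCycle ∧ p.toSubgraph = H}

/-- Any two distinct cycles of the graph have no vertex in common. -/
def SimpleGraph.HasPairwiseDisjointCycles {V : Type*} (G : SimpleGraph V) : Prop :=
  G.cycleSubgraphs.Pairwise fun H₁ H₂ => Disjoint H₁.verts H₂.verts

/-- The arithmetical rank of a radical ideal `I`: the minimum number of elements of the ring that
generate an ideal whose radical is `I` (`⊤` if no finite set of elements does). -/
noncomputable def Ideal.arithmeticalRank {R : Type*} [CommRing R] (I : Ideal R) : ℕ∞ :=
  ⨅ (s : Finset R) (_ : (Ideal.span (s : Set R)).radical = I), (s.card : ℕ∞)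

/-- The big height of an ideal: the maximum height of its minimal primes. -/
noncomputable def Ideal.bigHeight {R : Type*} [CommRing R] (I : Ideal R) : ℕ∞ :=
  ⨆ P ∈ I.minimalPrimes, P.height

/-! The minimal primes of the edge ideal `I(G)` are the ideals `(X v : v ∈ C)` with `C` a minimal
vertex cover, and such a prime has height `|C|`. This settles the big height.

The rest is induction on the edge set. Vertices are isolated rather than deleted, so the ring stays
fixed. With `G - S` for `G.isolate S` and `N(y)` for the neighbours of `y`, `I(G) = I(G - y) + y
(I(G - N(y)) + (N(y)))` (`edgeIdeal_eq_sup_mul`), and `IsGeneratedUpToRadical.cone` bounds the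
generators of such a sum by one more than those of its two pieces. If `y` is next to a leaf `x`, the
variable of `x` costs nothing, and the counts become the sizes of the minimal covers `C₁ ∪ {y}` and
`C₂ ∪ N(y)`. If `y` lies on a cycle nothing is saved, but both smaller graphs lose a cycle, which
pays for the extra element. Krull's height theorem gives the reverse inequality for forests.

For the projective dimension, `0 → R/(I : y) → R/I → R/(I + (y)) → 0` gives the upper bound by the
same recursion. For the lower bound, a minimal cover `C` gives a prime `P = I : y`, with `y` now the
product of the variables outside `C`; a nonzero class in `Ext^|C|(R/P, κ(P))` lifts to `R/I`. -/

namespace SimpleGraph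

/-! ### Minimal vertex covers, leaves and cycles -/

variable {V : Type*} {G H : SimpleGraph V} {C S : Set V} {x y : V}

/-- The graph obtained from `G` by isolating the vertices of `S`. -/
def isolate (G : SimpleGraph V) (S : Set V) : SimpleGraph V where
  Adj v w := G.Adj v w ∧ v ∉ S ∧ w ∉ S
  symm := ⟨fun _ _ h => ⟨h.1.symm, h.2.2, h.2.1⟩⟩
  loopless := ⟨fun _ h => h.1.ne rfl⟩

lemma isolate_adj {v w : V} : (G.isolate S).Adj v w ↔ G.Adj v w ∧ v ∉ S ∧ w ∉ S := Iff.rfl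

lemma isolate_le : G.isolate S ≤ G := fun _ _ h => h.1

lemma isolate_lt {v w : V} (h : G.Adj v w) (hv : v ∈ S) : G.isolate S < G :=
  lt_of_le_not_ge isolate_le fun hle => (hle h).2.1 hv

/-- A cover vertex can be dropped exactly when all its neighbours are in the cover. -/
lemma minimal_isVertexCover_iff :
    Minimal G.IsVertexCover C ↔ G.IsVertexCover C ∧ ∀ v ∈ C, ∃ w, G.Adj v w ∧ w ∉ C := by
  constructor
  · refine fun h => ⟨h.prop, fun v hv => ?_⟩
    by_contra! hw
    have hcov : G.IsVertexCover (C \ {v}) := by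
      intro a b hab
      have := h.prop hab
      have := hw a
      have := hw b
      have := hab.symm
      have := hab.ne
      grind
    exact (h.le_of_le hcov Set.sdiff_subset hv).2 rfl
  · refine fun ⟨hC, h⟩ => ⟨hC, fun D hD hDC v hv => ?_⟩
    obtain ⟨w, hvw, hw⟩ := h v hv
    exact (hD hvw).resolve_right fun hwD => hw (hDC hwD)

/-- The vertex `y` itself stays outside the new cover and witnesses that no neighbour of `y` can be
dropped. -/
lemma minimal_isVertexCover_union_neighborSet
    (hC : Minimal (G.isolate (G.neighborSet y)).IsVertexCover C) :
    Minimal G.IsVertexCover (C ∪ G.neighborSet y) ∧ Disjoint C (G.neighborSet y) := by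
  rw [minimal_isVertexCover_iff] at hC
  have hdisj : Disjoint C (G.neighborSet y) := by
    rw [Set.disjoint_left]
    intro v hv hvy
    obtain ⟨w, hw, -⟩ := hC.2 v hv
    exact hw.2.1 hvy
  refine ⟨minimal_isVertexCover_iff.2 ⟨fun v w hvw => ?_, fun v hv => ?_⟩, hdisj⟩
  · by_cases hv : v ∈ G.neighborSet y
    · exact Or.inl (Or.inr hv)
    by_cases hw : w ∈ G.neighborSet y
    · exact Or.inr (Or.inr hw)
    exact (hC.1 (show (G.isolate _).Adj v w from ⟨hvw, hv, hw⟩)).imp Or.inl Or.inl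
  · rcases hv with hv | hv
    · obtain ⟨w, hw, hwC⟩ := hC.2 v hv
      exact ⟨w, hw.1, fun h => h.elim hwC hw.2.2⟩
    · refine ⟨y, hv.symm, fun h => ?_⟩
      rcases h with h | h
      · obtain ⟨w, hw, -⟩ := hC.2 y h
        exact hw.2.2 hw.1
      · exact G.loopless.irrefl y h

lemma not_mem_of_minimal_isVertexCover_isolate
    (hC : Minimal (G.isolate S).IsVertexCover C) (hy : y ∈ S) : y ∉ C := fun h =>
  let ⟨_, hw, _⟩ := (minimal_isVertexCover_iff.1 hC).2 y h
  hw.2.1 hy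

lemma minimal_isVertexCover_insert (hC : Minimal (G.isolate {y}).IsVertexCover C)
    (hx : G.Adj y x) (hxC : x ∉ C) : Minimal G.IsVertexCover (insert y C) := by
  have hyC := not_mem_of_minimal_isVertexCover_isolate hC rfl
  rw [minimal_isVertexCover_iff] at hC ⊢
  refine ⟨fun v w hvw => ?_, fun v hv => ?_⟩
  · by_cases hv : v = y
    · exact Or.inl (Or.inl hv)
    by_cases hw : w = y
    · exact Or.inr (Or.inl hw)
    exact (hC.1 (show (G.isolate _).Adj v w from ⟨hvw, hv, hw⟩)).imp Or.inr Or.inr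
  · rcases hv with rfl | hv
    · exact ⟨x, hx, fun h => h.elim (fun h => hx.ne h.symm) hxC⟩
    · obtain ⟨w, hw, hwC⟩ := hC.2 v hv
      exact ⟨w, hw.1, fun h => h.elim hw.2.2 hwC⟩

/-- Either `y` has a neighbour outside `C` and can be added, or `C` already covers every edge at
`y`. -/
lemma exists_minimal_isVertexCover_superset (hC : Minimal (G.isolate {y}).IsVertexCover C) :
    ∃ D, Minimal G.IsVertexCover D ∧ C ⊆ D := by
  by_cases h : ∃ x, G.Adj y x ∧ x ∉ C
  · obtain ⟨x, hx, hxC⟩ := h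
    exact ⟨_, minimal_isVertexCover_insert hC hx hxC, Set.subset_insert _ _⟩
  · push Not at h
    refine ⟨C, ?_, subset_rfl⟩
    rw [minimal_isVertexCover_iff] at hC ⊢
    refine ⟨fun v w hvw => ?_, fun v hv => ?_⟩
    · by_cases hv : v = y
      · exact Or.inr (h w (hv ▸ hvw))
      by_cases hw : w = y
      · exact Or.inl (h v (hw ▸ hvw.symm))
      exact hC.1 (show (G.isolate _).Adj v w from ⟨hvw, hv, hw⟩)
    · obtain ⟨w, hw, hwC⟩ := hC.2 v hv
      exact ⟨w, hw.1, hwC⟩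

/-- A finite forest with an edge has a leaf. -/
lemma IsAcyclic.exists_leaf [Finite V] (h : G.IsAcyclic) (hG : G ≠ ⊥) :
    ∃ x y, G.Adj y x ∧ ∀ w, G.Adj x w → w = y := by
  obtain ⟨a, b, hab⟩ := ne_bot_iff_exists_adj.1 hG
  have : Nonempty V := ⟨a⟩
  -- The start of a longest path is a leaf: another neighbour would prolong the path or close a
  -- cycle.
  have ⟨u, v, p, hp, hmax⟩ := Walk.exists_isPath_forall_isPath_length_le_length G
  have hnil : ¬p.Nil := by
    intro hnil
    have := hmax _ _ (Path.singleton hab).1 (Path.singleton hab).2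
    have h0 := Walk.length_eq_zero_iff.2 hnil
    simp [h0] at this
  refine ⟨u, p.snd, (p.adj_snd hnil).symm, fun w hadj => h.eq_snd_of_adj_start hp hadj ?_⟩
  by_contra hw
  have := hmax _ _ _ (hp.cons (h := hadj.symm) hw)
  simp at this

lemma subgraph_map_ofLE_injective (h : H ≤ G) :
    Function.Injective (Subgraph.map (Hom.ofLE h)) := by
  intro K L hKL
  refine Subgraph.ext ?_ ?_
  · simpa using congrArg Subgraph.verts hKL
  · funext a b
    have := congrFun (congrFun (congrArg Subgraph.Adj hKL) a) b
    simpa [Relation.Map] using this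

lemma cycleSubgraphs_ncard_le [Finite V] (h : H ≤ G) :
    H.cycleSubgraphs.ncard ≤ G.cycleSubgraphs.ncard := by
  refine Set.ncard_le_ncard_of_injOn (Subgraph.map (Hom.ofLE h)) ?_
    (subgraph_map_ofLE_injective h).injOn (Set.toFinite _)
  rintro _ ⟨v, p, hp, rfl⟩
  exact ⟨v, p.mapLe h, (Walk.isCycle_mapLe h).2 hp, Walk.toSubgraph_map _ _⟩

/-- The cycle `p` has an edge at `y`, so it does not come from `H`. -/
lemma cycleSubgraphs_ncard_lt [Finite V] (h : H ≤ G) {p : G.Walk y y} (hp : p.IsCycle)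
    (hy : ∀ w, ¬ H.Adj y w) : H.cycleSubgraphs.ncard < G.cycleSubgraphs.ncard := by
  rw [← Set.ncard_image_of_injective _ (subgraph_map_ofLE_injective h)]
  refine Set.ncard_lt_ncard ⟨?_, fun hsub => ?_⟩ (Set.toFinite _)
  · rintro _ ⟨_, ⟨v, q, hq, rfl⟩, rfl⟩
    exact ⟨v, q.mapLe h, (Walk.isCycle_mapLe h).2 hq, Walk.toSubgraph_map _ _⟩
  · obtain ⟨K, -, hK⟩ := hsub ⟨y, p, hp, rfl⟩
    have hadj := p.toSubgraph_adj_snd hp.not_nil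
    rw [← hK, Subgraph.map_adj] at hadj
    obtain ⟨a, b, hab, rfl, rfl⟩ := hadj
    exact hy _ hab.adj_sub

lemma IsAcyclic.cycleSubgraphs_eq_empty (h : G.IsAcyclic) : G.cycleSubgraphs = ∅ :=
  Set.eq_empty_of_forall_notMem fun _ ⟨_, p, hp, _⟩ => h p hp

end SimpleGraph

/-! ### Generation up to radical -/

namespace Ideal

variable {R : Type*} [CommRing R] {I J L : Ideal R} {m n : ℕ}

/-- `I` contains a finite set of at most `m` elements whose span has radical containing `I`. -/
def IsGeneratedUpToRadical (I : Ideal R) (m : ℕ) : Prop :=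
  ∃ s : Finset R, s.card ≤ m ∧ span (s : Set R) ≤ I ∧ I ≤ (span (s : Set R)).radical

lemma IsGeneratedUpToRadical.mono (h : I.IsGeneratedUpToRadical m) (hmn : m ≤ n) :
    I.IsGeneratedUpToRadical n :=
  let ⟨s, hs, h⟩ := h
  ⟨s, hs.trans hmn, h⟩

lemma IsGeneratedUpToRadical.sup (hI : I.IsGeneratedUpToRadical m)
    (hJ : J.IsGeneratedUpToRadical n) : (I ⊔ J).IsGeneratedUpToRadical (m + n) := by
  classical
  obtain ⟨s, hs, hsI, hIs⟩ := hI
  obtain ⟨t, ht, htJ, hJt⟩ := hJ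
  refine ⟨s ∪ t, (Finset.card_union_le _ _).trans (add_le_add hs ht), ?_, ?_⟩
  · rw [Finset.coe_union, span_union]
    exact sup_le_sup hsI htJ
  · rw [Finset.coe_union, span_union]
    exact sup_le (hIs.trans (radical_mono le_sup_left)) (hJt.trans (radical_mono le_sup_right))

lemma isGeneratedUpToRadical_span {s : Set R} (hs : s.Finite) (hm : s.ncard ≤ m) :
    (span s).IsGeneratedUpToRadical m :=
  ⟨hs.toFinset, by rwa [← Set.ncard_eq_toFinset_card _ hs], by simp, by simpa using le_radical⟩

lemma IsGeneratedUpToRadical.arithmeticalRank_le (h : I.IsGeneratedUpToRadical m)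
    (hI : I.IsRadical) : I.arithmeticalRank ≤ m := by
  obtain ⟨s, hs, hsI, hIs⟩ := h
  have hrad : (span (s : Set R)).radical = I := le_antisymm (hI.radical_le_iff.2 hsI) hIs
  refine (iInf₂_le (f := fun (t : Finset R) (_ : (span (t : Set R)).radical = I) => (t.card : ℕ∞))
    s hrad).trans ?_
  exact_mod_cast hs

/-- Padding with zeros gives families of length exactly `m`, so that the matrix in `cone` is square.
-/
lemma IsGeneratedUpToRadical.exists_fin (h : I.IsGeneratedUpToRadical m) :
    ∃ f : Fin m → R, (∀ i, f i ∈ I) ∧ I ≤ (span (Set.range f)).radical := by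
  obtain ⟨s, hs, hsI, hIs⟩ := h
  refine ⟨fun i => s.toList.getD i 0, fun i => ?_, hIs.trans (radical_mono (span_mono ?_))⟩
  · dsimp only
    rw [List.getD_eq_getElem?_getD]
    rcases lt_or_ge (i : ℕ) s.toList.length with hi | hi
    · rw [List.getElem?_eq_getElem hi]
      exact hsI (subset_span (Finset.mem_coe.2 (Finset.mem_toList.1 (List.getElem_mem hi))))
    · rw [List.getElem?_eq_none hi]
      exact I.zero_mem
  · intro a ha
    obtain ⟨k, hk, rfl⟩ := List.getElem_of_mem (Finset.mem_toList.2 (Finset.mem_coe.1 ha))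
    exact ⟨⟨k, hk.trans_le (by simpa using hs)⟩, by simp only [List.getD_eq_getElem _ _ hk]⟩

lemma isGeneratedUpToRadical_of_fin {f : Fin m → R} (hf : ∀ i, f i ∈ I)
    (h : I ≤ (span (Set.range f)).radical) : I.IsGeneratedUpToRadical m := by
  classical
  refine ⟨Finset.univ.image f, Finset.card_image_le.trans (by simp), ?_, by simpa using h⟩
  rw [span_le]
  intro a
  simp only [Finset.coe_image, Finset.coe_univ, Set.image_univ]
  rintro ⟨i, rfl⟩
  exact hf i

/-- The determinant of `A + y` differs from a power of `y` by an element of any ideal containing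
the entries of `A`. -/
lemma det_add_scalar_sub_pow_mem {ι : Type*} [Fintype ι] [DecidableEq ι] (A : Matrix ι ι R)
    (hA : ∀ i j, A i j ∈ L) (y : R) :
    (A + Matrix.scalar ι y).det - y ^ Fintype.card ι ∈ L := by
  rw [← Quotient.eq, RingHom.map_det]
  have : (Quotient.mk L).mapMatrix (A + Matrix.scalar ι y) =
      Matrix.scalar ι (Quotient.mk L y) := by
    ext i j
    rw [RingHom.mapMatrix_apply, Matrix.map_apply, Matrix.add_apply, map_add,
      Quotient.eq_zero_iff_mem.2 (hA i j), zero_add]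
    by_cases h : i = j <;> simp [h]
  rw [this]
  simp

/-- If `J ≤ L` are generated by `m` elements up to radical, then `J + y (L + (x))` is generated
by `m + 1` elements up to radical. -/
lemma IsGeneratedUpToRadical.cone (hJL : J ≤ L) (hJ : J.IsGeneratedUpToRadical m)
    (hL : L.IsGeneratedUpToRadical m) (x y : R) :
    (J ⊔ span {y} * (L ⊔ span {x})).IsGeneratedUpToRadical (m + 1) := by
  obtain ⟨f, hf, hJf⟩ := hJ.exists_fin
  obtain ⟨g, hg, hLg⟩ := hL.exists_fin
  -- The extra factor `f j` puts the coefficients in `L` and keeps the exponent positive.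
  have hpow : ∀ j, ∃ N : ℕ, ∃ a : Fin m → R,
      (∀ k, a k ∈ L) ∧ ∑ k, a k * g k = f j ^ (N + 1) := by
    intro j
    obtain ⟨N, hN⟩ := hLg (hJL (hf j))
    obtain ⟨c, hc⟩ := mem_span_range_iff_exists_fun.1 hN
    refine ⟨N, fun k => f j * c k, fun k => L.mul_mem_right _ (hJL (hf j)), ?_⟩
    simp_rw [mul_assoc, ← Finset.mul_sum, hc, pow_succ']
  choose N A hA hAg using hpow
  set M : Matrix (Fin m) (Fin m) R := Matrix.of A + Matrix.scalar (Fin m) y with hM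
  have hMg : ∀ j, M.mulVec g j = f j ^ (N j + 1) + y * g j := by
    intro j
    rw [hM, Matrix.add_mulVec, Pi.add_apply, ← hAg]
    simp [Matrix.mulVec, dotProduct, Matrix.diagonal_apply]
  have hD : M.det - y ^ m ∈ L := by
    have := det_add_scalar_sub_pow_mem (Matrix.of A) hA y
    rwa [Fintype.card_fin] at this
  have hyL : ∀ z ∈ L ⊔ span {x}, y * z ∈ J ⊔ span {y} * (L ⊔ span {x}) := fun z hz =>
    mem_sup_right (mul_mem_mul (mem_span_singleton_self y) hz)
  -- The first `m` elements are the entries of `M g`. The last one makes `det M` invertible away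
  -- from `y = 0` and then forces `x` to vanish.
  refine isGeneratedUpToRadical_of_fin
    (f := Fin.snoc (fun j => f j ^ (N j + 1) + y * g j) (y * (x * M.det + (M.det - y ^ m)))) ?_ ?_
  · intro i
    refine Fin.lastCases ?_ (fun j => ?_) i
    · rw [Fin.snoc_last]
      exact hyL _ (add_mem (mem_sup_right (mul_mem_right _ _ (mem_span_singleton_self x)))
        (mem_sup_left hD))
    · rw [Fin.snoc_castSucc]
      exact add_mem (mem_sup_left (pow_mem_of_mem _ (hf j) _ (Nat.succ_pos _)))
        (hyL _ (mem_sup_left (hg j)))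
  · rw [radical_eq_sInf]
    refine le_sInf fun P ⟨hP, hPprime⟩ => ?_
    have h1 : ∀ j, f j ^ (N j + 1) + y * g j ∈ P := fun j =>
      hP (subset_span ⟨Fin.castSucc j, by simp⟩)
    have h2 : y * (x * M.det + (M.det - y ^ m)) ∈ P :=
      hP (subset_span ⟨Fin.last m, by simp⟩)
    by_cases hy : y ∈ P
    · refine sup_le (hJf.trans ?_) (mul_le.2 fun r hr s _ => ?_)
      · rw [hPprime.radical_le_iff, span_le]
        rintro _ ⟨j, rfl⟩
        exact hPprime.mem_of_pow_mem _ ((P.add_mem_iff_left (P.mul_mem_right _ hy)).1 (h1 j))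
      · exact P.mul_mem_right _ ((span_singleton_le_iff_mem _).2 hy hr)
    -- By Cramer's rule `det M` multiplies every `g k` into `P`. Were `det M` in `P`, `h3` would put
    -- `y ^ m` there.
    · have h3 := (hPprime.mem_or_mem h2).resolve_left hy
      have hDg : ∀ k, M.det * g k ∈ P := by
        intro k
        have : M.det * g k = ∑ j, M.adjugate k j * M.mulVec g j := by
          have := congrFun (congrArg (fun B => Matrix.mulVec B g) M.adjugate_mul) k
          rw [← Matrix.mulVec_mulVec] at this
          rw [Matrix.smul_mulVec, Matrix.one_mulVec] at this
          exact this.symm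
        rw [this]
        exact P.sum_mem fun j _ => P.mul_mem_left _ ((hMg j).symm ▸ h1 j)
      have hdet : M.det ∉ P := by
        intro hdet
        have : y ^ m ∈ P := by
          have h4 : x * M.det + M.det - (x * M.det + (M.det - y ^ m)) ∈ P :=
            P.sub_mem (P.add_mem (P.mul_mem_left _ hdet) hdet) h3
          convert h4 using 1
          ring
        exact hy (hPprime.mem_of_pow_mem _ this)
      have hLP : L ≤ P := by
        refine hLg.trans ?_
        rw [hPprime.radical_le_iff, span_le]
        rintro _ ⟨k, rfl⟩
        exact (hPprime.mem_or_mem (hDg k)).resolve_left hdet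
      have hxP : x ∈ P :=
        (hPprime.mem_or_mem ((P.add_mem_iff_left (hLP hD)).1 h3)).resolve_right hdet
      exact sup_le (hJL.trans hLP)
        (mul_le.2 fun _ _ _ hs => P.mul_mem_left _
          (sup_le hLP ((span_singleton_le_iff_mem _).2 hxP) hs))

/-- Krull's height theorem, since an ideal and its radical have the same minimal primes. -/
lemma bigHeight_le_arithmeticalRank [IsNoetherianRing R] (I : Ideal R) :
    I.bigHeight ≤ I.arithmeticalRank := by
  refine le_iInf₂ fun s hs => iSup₂_le fun P hP => ?_
  rw [← hs, radical_minimalPrimes] at hP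
  exact height_le_card_of_mem_minimalPrimes_span_finset hP

end Ideal

/-! ### Edge ideals as monomial ideals and their minimal primes -/

namespace SimpleGraph

variable {V : Type*} (G : SimpleGraph V) (K : Type*) [Field K] {S C : Set V}

/-- The sum of the edge ideal of `G` and the ideal generated by the variables in `S`. -/
noncomputable def edgeVarIdeal (S : Set V) : Ideal (MvPolynomial V K) :=
  G.edgeIdeal K ⊔ Ideal.span (X '' S)

variable {G K}

lemma mem_edgeVarIdeal {f : MvPolynomial V K} :
    f ∈ G.edgeVarIdeal K S ↔ ∀ m ∈ f.support,
      (∃ v ∈ S, m v ≠ 0) ∨ ∃ v w, G.Adj v w ∧ m v ≠ 0 ∧ m w ≠ 0 := by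
  classical
  have h : G.edgeVarIdeal K S = Ideal.span ((fun s => monomial s (1 : K)) ''
      ({s | ∃ v w, G.Adj v w ∧ s = Finsupp.single v 1 + Finsupp.single w 1} ∪
        (fun v => Finsupp.single v 1) '' S)) := by
    rw [edgeVarIdeal, edgeIdeal, ← Ideal.span_union, Set.image_union, Set.image_image]
    congr 2
    ext f
    constructor
    · rintro ⟨v, w, h, rfl⟩
      exact ⟨_, ⟨v, w, h, rfl⟩, by simp [X, monomial_mul]⟩
    · rintro ⟨_, ⟨v, w, h, rfl⟩, rfl⟩
      exact ⟨v, w, h, by simp [X, monomial_mul]⟩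
  rw [h, mem_ideal_span_monomial_image]
  refine forall₂_congr fun m _ => ⟨?_, ?_⟩
  · rintro ⟨s, ⟨v, w, hvw, rfl⟩ | ⟨v, hv, rfl⟩, hs⟩
    · refine Or.inr ⟨v, w, hvw, ?_, ?_⟩
      · have := hs v
        simp at this
        omega
      · have := hs w
        simp at this
        omega
    · exact Or.inl ⟨v, hv, by have := hs v; simp at this; omega⟩
  · rintro (⟨v, hv, hm⟩ | ⟨v, w, hvw, hv, hw⟩)
    · refine ⟨_, Or.inr ⟨v, hv, rfl⟩, ?_⟩
      simpa [Nat.one_le_iff_ne_zero] using hm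
    · refine ⟨_, Or.inl ⟨v, w, hvw, rfl⟩, fun u => ?_⟩
      have := hvw.ne
      by_cases h1 : u = v
      · subst h1
        simp [this.symm]
        omega
      · by_cases h2 : u = w
        · subst h2
          simp [this]
          omega
        · simp [Ne.symm h1, Ne.symm h2]

variable (G K) in
lemma edgeVarIdeal_empty : G.edgeVarIdeal K ∅ = G.edgeIdeal K := by
  simp [edgeVarIdeal]

variable (G K S) in
lemma edgeVarIdeal_insert (v : V) :
    G.edgeVarIdeal K (insert v S) = G.edgeVarIdeal K S ⊔ Ideal.span {X v} := by
  rw [edgeVarIdeal, edgeVarIdeal, Set.image_insert_eq, Ideal.span_insert, sup_assoc,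
    sup_comm (Ideal.span {X v})]

lemma X_mul_X_mem_edgeIdeal {v w : V} (h : G.Adj v w) :
    (X v * X w : MvPolynomial V K) ∈ G.edgeIdeal K :=
  Ideal.subset_span ⟨v, w, h, rfl⟩

lemma edgeIdeal_le_iff {I : Ideal (MvPolynomial V K)} :
    G.edgeIdeal K ≤ I ↔ ∀ v w, G.Adj v w → (X v * X w : MvPolynomial V K) ∈ I := by
  rw [edgeIdeal, Ideal.span_le]
  exact ⟨fun h v w hvw => h ⟨v, w, hvw, rfl⟩, by rintro h _ ⟨v, w, hvw, rfl⟩; exact h v w hvw⟩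

variable (K) in
/-- The ideal generated by the variables in a set is prime. -/
lemma isPrime_span_X_image (C : Set V) :
    (Ideal.span (X '' C : Set (MvPolynomial V K))).IsPrime := by
  classical
  let φ : MvPolynomial V K →ₐ[K] MvPolynomial V K := aeval fun v => if v ∈ C then 0 else X v
  suffices h : Ideal.span (X '' C : Set (MvPolynomial V K)) = RingHom.ker φ by
    rw [h]
    exact RingHom.ker_isPrime _
  refine le_antisymm ?_ fun f hf => ?_
  · rw [Ideal.span_le]
    rintro _ ⟨v, hv, rfl⟩
    simp [φ, hv]
  -- Modulo the variables in `C`, the substitution `φ` is the identity.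
  · have hφ : (Ideal.Quotient.mkₐ K (Ideal.span (X '' C))).comp φ =
        Ideal.Quotient.mkₐ K (Ideal.span (X '' C : Set (MvPolynomial V K))) := by
      refine algHom_ext fun v => ?_
      by_cases hv : v ∈ C
      · have : Ideal.Quotient.mk (Ideal.span (X '' C : Set (MvPolynomial V K))) (X v) = 0 :=
          Ideal.Quotient.eq_zero_iff_mem.2 (Ideal.subset_span ⟨v, hv, rfl⟩)
        simp [φ, hv, this]
      · simp [φ, hv]
    have := DFunLike.congr_fun hφ f
    rw [AlgHom.comp_apply, show φ f = 0 from hf, map_zero] at this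
    exact Ideal.Quotient.eq_zero_iff_mem.1 this.symm

lemma X_mem_span_X_image {v : V} :
    (X v : MvPolynomial V K) ∈ Ideal.span (X '' C : Set (MvPolynomial V K)) ↔ v ∈ C := by
  classical
  refine ⟨fun h => ?_, fun h => Ideal.subset_span ⟨v, h, rfl⟩⟩
  obtain ⟨i, hi, hne⟩ := mem_ideal_span_X_image.1 h (Finsupp.single v 1) (by simp [support_X])
  rw [Finsupp.single_apply] at hne
  split_ifs at hne with hvi
  · exact hvi ▸ hi
  · exact absurd rfl hne

lemma isVertexCover_of_edgeIdeal_le {P : Ideal (MvPolynomial V K)} [P.IsPrime]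
    (h : G.edgeIdeal K ≤ P) : G.IsVertexCover {v | X v ∈ P} := fun _ _ hvw =>
  Ideal.IsPrime.mem_or_mem ‹_› (h (X_mul_X_mem_edgeIdeal hvw))

lemma edgeIdeal_le_span_X_image (hC : G.IsVertexCover C) :
    G.edgeIdeal K ≤ Ideal.span (X '' C) := by
  refine edgeIdeal_le_iff.2 fun v w hvw => ?_
  rcases hC hvw with h | h
  · exact Ideal.mul_mem_right _ _ (X_mem_span_X_image.2 h)
  · exact Ideal.mul_mem_left _ _ (X_mem_span_X_image.2 h)

variable (G K) in
lemma edgeIdeal_isRadical : (G.edgeIdeal K).IsRadical := by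
  rw [← Ideal.radical_eq_iff]
  refine le_antisymm (fun f hf => ?_) Ideal.le_radical
  rw [← edgeVarIdeal_empty, mem_edgeVarIdeal]
  intro m hm
  right
  by_contra! hcon
  -- If no edge divides `m`, the variables missing from `m` generate a prime over the edge ideal,
  -- and `m` avoids it.
  have hcov : G.IsVertexCover {v | m v = 0} := fun v w hvw => by
    by_cases hv : m v = 0
    · exact Or.inl hv
    · exact Or.inr (hcon v w hvw hv)
  have := (isPrime_span_X_image K {v | m v = 0}).radical_le_iff.2
    (edgeIdeal_le_span_X_image hcov) hf
  obtain ⟨i, hi, hne⟩ := mem_ideal_span_X_image.1 this m hm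
  exact hne hi

lemma span_X_image_le_iff {P : Ideal (MvPolynomial V K)} :
    Ideal.span (X '' C) ≤ P ↔ C ⊆ {v | X v ∈ P} := by
  rw [Ideal.span_le]
  exact Set.image_subset_iff

lemma span_X_image_mem_minimalPrimes (hC : Minimal G.IsVertexCover C) :
    Ideal.span (X '' C) ∈ (G.edgeIdeal K).minimalPrimes := by
  refine ⟨⟨isPrime_span_X_image K C, edgeIdeal_le_span_X_image hC.prop⟩, fun P ⟨hP, hle⟩ hPC => ?_⟩
  rw [span_X_image_le_iff]
  exact hC.le_of_le (isVertexCover_of_edgeIdeal_le hle) fun v hv => X_mem_span_X_image.1 (hPC hv)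

/-- The variables in `P` already generate a prime over the edge ideal. -/
lemma exists_of_mem_minimalPrimes {P : Ideal (MvPolynomial V K)}
    (hP : P ∈ (G.edgeIdeal K).minimalPrimes) :
    ∃ C, Minimal G.IsVertexCover C ∧ P = Ideal.span (X '' C) := by
  have := hP.1.1
  have hcov := isVertexCover_of_edgeIdeal_le hP.1.2
  have hle : ∀ D, G.IsVertexCover D → D ⊆ {v | X v ∈ P} → P ≤ Ideal.span (X '' D) :=
    fun D hD hDP => hP.2 ⟨isPrime_span_X_image K D, edgeIdeal_le_span_X_image hD⟩
      (span_X_image_le_iff.2 hDP)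
  refine ⟨_, ⟨hcov, fun D hD hDP v hv => X_mem_span_X_image.1 (hle D hD hDP hv)⟩, ?_⟩
  exact le_antisymm (hle _ hcov subset_rfl) (span_X_image_le_iff.2 subset_rfl)

variable (K) in
lemma height_span_X_image [Finite V] (C : Set V) :
    (Ideal.span (X '' C : Set (MvPolynomial V K))).height = C.encard := by
  refine le_antisymm ?_ ?_
  · have hprime := isPrime_span_X_image K C
    refine (Ideal.height_le_card_of_mem_minimalPrimes_span ((Set.toFinite C).image X)
      ⟨⟨hprime, le_rfl⟩, fun Q hQ _ => hQ.2⟩).trans ?_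
    rw [← Set.Finite.cast_ncard_eq (Set.toFinite C)]
    exact_mod_cast Set.ncard_image_le (Set.toFinite C)
  · induction C, Set.toFinite C using Set.Finite.induction_on with
    | empty => simp
    | @insert v C hv _ ih =>
      have := isPrime_span_X_image K C
      have := isPrime_span_X_image K (insert v C)
      rw [Set.encard_insert_of_notMem hv]
      refine (add_le_add_left ih 1).trans (Ideal.height_add_one_le_of_lt_of_isPrime ?_)
      refine lt_of_le_of_ne (Ideal.span_mono (Set.image_mono (Set.subset_insert v C))) fun h => hv ?_
      exact X_mem_span_X_image.1 (h ▸ X_mem_span_X_image.2 (Set.mem_insert v C))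

variable (G K) in
/-- The big height of the edge ideal is the largest size of a minimal vertex cover. -/
theorem isGreatest_bigHeight_edgeIdeal [Finite V] :
    IsGreatest {k : ℕ∞ | ∃ C : Set V, Minimal G.IsVertexCover C ∧ C.encard = k}
      (G.edgeIdeal K).bigHeight := by
  have hle : ∀ C, Minimal G.IsVertexCover C → C.encard ≤ (G.edgeIdeal K).bigHeight := by
    intro C hC
    rw [← height_span_X_image K C]
    exact le_iSup₂ (f := fun (P : Ideal (MvPolynomial V K))
      (_ : P ∈ (G.edgeIdeal K).minimalPrimes) => P.height) _ (span_X_image_mem_minimalPrimes hC)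
  obtain ⟨C₀, -, hC₀⟩ := (Set.toFinite {C : Set V | G.IsVertexCover C}).exists_le_minimal
    (a := Set.univ) isVertexCover_univ
  obtain ⟨C, hC, hmax⟩ := Set.exists_max_image {C | Minimal G.IsVertexCover C} Set.encard
    (Set.toFinite _) ⟨C₀, hC₀⟩
  refine ⟨⟨C, hC, le_antisymm (hle C hC) (iSup₂_le fun P hP => ?_)⟩, ?_⟩
  · obtain ⟨D, hD, rfl⟩ := exists_of_mem_minimalPrimes hP
    rw [height_span_X_image]
    exact hmax D hD
  · rintro _ ⟨D, hD, rfl⟩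
    exact hle D hD

end SimpleGraph

/-! ### The bound on the arithmetical rank -/

namespace SimpleGraph

variable {V : Type*} {G : SimpleGraph V} {K : Type*} [Field K] {S : Set V} {x y : V}

variable (G K) in
-- Edges at `y` account for `y N(y)`. The edges of `G - N(y)` in the second factor are redundant,
-- but put the first summand inside that factor, as `cone` needs.
lemma edgeIdeal_eq_sup_mul (y : V) :
    G.edgeIdeal K = (G.isolate {y}).edgeIdeal K ⊔ Ideal.span {X y} *
      (G.isolate (G.neighborSet y)).edgeVarIdeal K (G.neighborSet y) := by
  refine le_antisymm (edgeIdeal_le_iff.2 fun v w hvw => ?_) (sup_le ?_ (Ideal.mul_le.2 ?_))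
  · have key : ∀ u, G.Adj y u → (X y * X u : MvPolynomial V K) ∈ Ideal.span {X y} *
        (G.isolate (G.neighborSet y)).edgeVarIdeal K (G.neighborSet y) := fun u hu =>
      Ideal.mul_mem_mul (Ideal.mem_span_singleton_self _)
        (Ideal.mem_sup_right (Ideal.subset_span ⟨u, hu, rfl⟩))
    by_cases hv : v = y
    · exact Ideal.mem_sup_right (hv ▸ key w (hv ▸ hvw))
    by_cases hw : w = y
    · rw [mul_comm (X v)]
      exact Ideal.mem_sup_right (hw ▸ key v (hw ▸ hvw.symm))
    exact Ideal.mem_sup_left (X_mul_X_mem_edgeIdeal ⟨hvw, hv, hw⟩)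
  · exact edgeIdeal_le_iff.2 fun v w hvw => X_mul_X_mem_edgeIdeal hvw.1
  · intro r hr s hs
    obtain ⟨c, rfl⟩ := Ideal.mem_span_singleton'.1 hr
    rw [mul_assoc]
    refine Ideal.mul_mem_left _ c ?_
    suffices h : (G.isolate (G.neighborSet y)).edgeVarIdeal K (G.neighborSet y) ≤
        Submodule.comap (LinearMap.mulLeft (MvPolynomial V K) (X y)) (G.edgeIdeal K) from h hs
    refine sup_le (edgeIdeal_le_iff.2 fun v w hvw => ?_) (Ideal.span_le.2 ?_)
    · change X y * (X v * X w) ∈ G.edgeIdeal K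
      exact Ideal.mul_mem_left _ _ (X_mul_X_mem_edgeIdeal hvw.1)
    · rintro _ ⟨v, hv, rfl⟩
      exact X_mul_X_mem_edgeIdeal hv

/-- A neighbour of `y` with no other edge may be left out of `S`; this is how the leaf is spared. -/
lemma edgeIdeal_isolate_le_edgeVarIdeal
    (hS : ∀ v w, G.Adj v w → v ≠ y → w ≠ y → v ∈ G.neighborSet y → v ∈ S) :
    (G.isolate {y}).edgeIdeal K ≤ (G.isolate (G.neighborSet y)).edgeVarIdeal K S := by
  refine edgeIdeal_le_iff.2 fun v w hvw => ?_
  have hmem : ∀ u ∈ S, (X u : MvPolynomial V K) ∈ Ideal.span (X '' S) :=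
    fun u hu => X_mem_span_X_image.2 hu
  by_cases hv : v ∈ G.neighborSet y
  · exact Ideal.mem_sup_right (Ideal.mul_mem_right _ _ (hmem v (hS v w hvw.1 hvw.2.1 hvw.2.2 hv)))
  by_cases hw : w ∈ G.neighborSet y
  · exact Ideal.mem_sup_right
      (Ideal.mul_mem_left _ _ (hmem w (hS w v hvw.1.symm hvw.2.2 hvw.2.1 hw)))
  exact Ideal.mem_sup_left (X_mul_X_mem_edgeIdeal ⟨hvw.1, hv, hw⟩)

lemma isGeneratedUpToRadical_edgeVarIdeal [Finite V] {m : ℕ}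
    (h : (G.edgeIdeal K).IsGeneratedUpToRadical m) :
    (G.edgeVarIdeal K S).IsGeneratedUpToRadical (m + S.ncard) :=
  h.sup (Ideal.isGeneratedUpToRadical_span ((Set.toFinite S).image _)
    (Set.ncard_image_le (Set.toFinite S)))

lemma not_mem_of_minimal_isVertexCover_isolate_of_leaf {C : Set V} (hx : ∀ w, G.Adj x w → w = y)
    (hC : Minimal (G.isolate {y}).IsVertexCover C) : x ∉ C := fun h =>
  let ⟨w, hw, _⟩ := (minimal_isVertexCover_iff.1 hC).2 x h
  hw.2.2 (hx w hw.1)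

variable (G K) in
/-- The edge ideal of a graph is generated up to radical by as many elements as the sum of the
cardinality of some minimal vertex cover and the number of cycles. -/
theorem exists_minimal_isVertexCover_isGeneratedUpToRadical [Finite V] :
    ∃ C, Minimal G.IsVertexCover C ∧
      (G.edgeIdeal K).IsGeneratedUpToRadical (C.ncard + G.cycleSubgraphs.ncard) := by
  induction G using WellFoundedLT.induction with
  | ind G ih =>
  rcases eq_or_ne G ⊥ with rfl | hG
  · refine ⟨∅, minimal_isVertexCover_iff.2 ⟨isVertexCover_bot _, by simp⟩, ∅, by simp, by simp, ?_⟩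
    exact edgeIdeal_le_iff.2 fun v w hvw => hvw.elim
  by_cases hac : G.IsAcyclic
  · obtain ⟨x, y, hyx, hx⟩ := hac.exists_leaf hG
    obtain ⟨C₁, hC₁, hJ⟩ := ih (G.isolate {y}) (isolate_lt hyx rfl)
    obtain ⟨C₂, hC₂, hL⟩ := ih (G.isolate (G.neighborSet y)) (isolate_lt hyx.symm hyx)
    have hxC := not_mem_of_minimal_isVertexCover_isolate_of_leaf hx hC₁
    have hmin₁ := minimal_isVertexCover_insert hC₁ hyx hxC
    obtain ⟨hmin₂, hdisj⟩ := minimal_isVertexCover_union_neighborSet hC₂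
    have hcard₁ := Set.ncard_insert_of_notMem
      (not_mem_of_minimal_isVertexCover_isolate hC₁ rfl) (Set.toFinite C₁)
    have hcard₂ := Set.ncard_union_eq hdisj (Set.toFinite _) (Set.toFinite _)
    have hcard₃ := Set.ncard_sdiff_singleton_add_one (show x ∈ G.neighborSet y from hyx)
      (Set.toFinite _)
    have hn₁ := cycleSubgraphs_ncard_le (isolate_le : G.isolate {y} ≤ G)
    have hn₂ := cycleSubgraphs_ncard_le (isolate_le : G.isolate (G.neighborSet y) ≤ G)
    have hL' := isGeneratedUpToRadical_edgeVarIdeal (S := G.neighborSet y \ {x}) hL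
    -- The leaf is the `x` of `cone`, so the added `1` restores either `y` to `C₁` or `x` to `N(y)`.
    have hgen := Ideal.IsGeneratedUpToRadical.cone
      (edgeIdeal_isolate_le_edgeVarIdeal (G := G) (S := G.neighborSet y \ {x})
        fun v w hvw hv hw hvy => ⟨hvy, fun hvx => hw (hx w (hvx ▸ hvw))⟩)
      (hJ.mono (le_max_left _ _)) (hL'.mono (le_max_right _ _)) (X x) (X y)
    rw [← edgeVarIdeal_insert, Set.insert_sdiff_singleton,
      Set.insert_eq_of_mem (show x ∈ G.neighborSet y from hyx), ← edgeIdeal_eq_sup_mul] at hgen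
    rcases le_total (C₁.ncard + (G.isolate {y}).cycleSubgraphs.ncard)
      (C₂.ncard + (G.isolate (G.neighborSet y)).cycleSubgraphs.ncard +
        (G.neighborSet y \ {x}).ncard) with hle | hle
    · rw [max_eq_right hle] at hgen
      exact ⟨_, hmin₂, hgen.mono (by omega)⟩
    · rw [max_eq_left hle] at hgen
      exact ⟨_, hmin₁, hgen.mono (by omega)⟩
  · rw [IsAcyclic] at hac
    push Not at hac
    obtain ⟨y, p, hp⟩ := hac
    have hyx := p.adj_snd hp.not_nil
    obtain ⟨C₁, hC₁, hJ⟩ := ih (G.isolate {y}) (isolate_lt hyx rfl)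
    obtain ⟨C₂, hC₂, hL⟩ := ih (G.isolate (G.neighborSet y)) (isolate_lt hyx.symm hyx)
    obtain ⟨D₁, hmin₁, hle₁⟩ := exists_minimal_isVertexCover_superset hC₁
    obtain ⟨hmin₂, hdisj⟩ := minimal_isVertexCover_union_neighborSet hC₂
    have hcard₁ := Set.ncard_le_ncard hle₁ (Set.toFinite D₁)
    have hcard₂ := Set.ncard_union_eq hdisj (Set.toFinite _) (Set.toFinite _)
    have hn₁ := cycleSubgraphs_ncard_lt (isolate_le : G.isolate {y} ≤ G) hp fun w hw => hw.2.1 rfl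
    have hn₂ := cycleSubgraphs_ncard_lt (isolate_le : G.isolate (G.neighborSet y) ≤ G) hp
      fun w hw => hw.2.2 hw.1
    have hL' := isGeneratedUpToRadical_edgeVarIdeal (S := G.neighborSet y) hL
    -- With `x = 0` all of `N(y)` is counted; the added `1` is absorbed by `hn₁` or `hn₂`.
    have hgen := Ideal.IsGeneratedUpToRadical.cone
      (edgeIdeal_isolate_le_edgeVarIdeal fun v w _ _ _ hvy => hvy)
      (hJ.mono (le_max_left _ _)) (hL'.mono (le_max_right _ _)) 0 (X y)
    rw [Ideal.span_singleton_eq_bot.2 rfl, sup_bot_eq, ← edgeIdeal_eq_sup_mul] at hgen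
    rcases le_total (C₁.ncard + (G.isolate {y}).cycleSubgraphs.ncard)
      (C₂.ncard + (G.isolate (G.neighborSet y)).cycleSubgraphs.ncard +
        (G.neighborSet y).ncard) with hle | hle
    · rw [max_eq_right hle] at hgen
      exact ⟨_, hmin₂, hgen.mono (by omega)⟩
    · rw [max_eq_left hle] at hgen
      exact ⟨_, hmin₁, hgen.mono (by omega)⟩

variable (G K) in
/-- The arithmetical rank of an edge ideal is at most the sum of its big height and the number of
cycles of the graph. -/
theorem arithmeticalRank_edgeIdeal_le [Finite V] :
    (G.edgeIdeal K).arithmeticalRank ≤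
      (G.edgeIdeal K).bigHeight + G.cycleSubgraphs.encard := by
  obtain ⟨C, hC, hgen⟩ := exists_minimal_isVertexCover_isGeneratedUpToRadical G K
  refine (hgen.arithmeticalRank_le (edgeIdeal_isRadical G K)).trans ?_
  rw [Nat.cast_add, Set.Finite.cast_ncard_eq (Set.toFinite _),
    Set.Finite.cast_ncard_eq (Set.toFinite _)]
  gcongr
  exact (isGreatest_bigHeight_edgeIdeal G K).2 ⟨C, hC, rfl⟩

end SimpleGraph

/-! ### Colon sequences and `Ext` -/

namespace Ideal

open CategoryTheory Abelian

universe u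

variable {R : Type u} [CommRing R] {A I B : Ideal R} {y : R}

/-- Multiplication by `y` as a map from `R ⧸ (I : y)` to `R ⧸ I`. -/
noncomputable def quotientMulHom (hA : ∀ f, y * f ∈ I ↔ f ∈ A) :
    ModuleCat.of R (R ⧸ A) ⟶ ModuleCat.of R (R ⧸ I) :=
  ModuleCat.ofHom (Submodule.mapQ A I (LinearMap.lsmul R R y) fun f hf => (hA f).2 hf)

lemma quotientMulHom_self (hI : ∀ f, y * f ∈ I ↔ f ∈ I) :
    quotientMulHom hI = y • 𝟙 (ModuleCat.of R (R ⧸ I)) := by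
  ext : 1
  refine Submodule.linearMap_qext _ (LinearMap.ext_ring ?_)
  rfl

/-- The complex `R ⧸ A ⟶ R ⧸ I ⟶ R ⧸ B` given by multiplication by `y` and the projection. It is
short exact when `A = I : y` and `B = I + (y)`. -/
noncomputable abbrev quotientColonComplex (hA : ∀ f, y * f ∈ I ↔ f ∈ A) (hB : I ⊔ span {y} = B) :
    ShortComplex (ModuleCat.{u} R) where
  X₁ := ModuleCat.of R (R ⧸ A)
  X₂ := ModuleCat.of R (R ⧸ I)
  X₃ := ModuleCat.of R (R ⧸ B)
  f := quotientMulHom hA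
  g := ModuleCat.ofHom (Submodule.mapQ I B LinearMap.id fun _ hf => hB ▸ mem_sup_left hf)
  zero := by
    ext : 1
    refine Submodule.linearMap_qext _ (LinearMap.ext_ring ?_)
    exact (Submodule.Quotient.mk_eq_zero _).2
      (B.mul_mem_right _ (hB ▸ mem_sup_right (mem_span_singleton_self y)))

lemma quotientColonComplex_shortExact (hA : ∀ f, y * f ∈ I ↔ f ∈ A) (hB : I ⊔ span {y} = B) :
    (quotientColonComplex hA hB).ShortExact where
  exact := by
    rw [ShortComplex.moduleCat_exact_iff]
    intro f hf
    obtain ⟨f, rfl⟩ := Submodule.Quotient.mk_surjective _ f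
    have hf : f ∈ B := (Submodule.Quotient.mk_eq_zero _).1 hf
    rw [← hB] at hf
    obtain ⟨a, ha, b, hb, rfl⟩ := Submodule.mem_sup.1 hf
    obtain ⟨c, rfl⟩ := mem_span_singleton'.1 hb
    refine ⟨Submodule.Quotient.mk c, (Submodule.Quotient.eq _).2 ?_⟩
    have : y * c - (a + c * y) = -a := by ring
    change y * c - (a + c * y) ∈ I
    rw [this]
    exact I.neg_mem ha
  mono_f := by
    rw [ModuleCat.mono_iff_injective, injective_iff_map_eq_zero]
    intro f hf
    obtain ⟨f, rfl⟩ := Submodule.Quotient.mk_surjective _ f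
    exact (Submodule.Quotient.mk_eq_zero _).2 ((hA f).1 ((Submodule.Quotient.mk_eq_zero _).1 hf))
  epi_g := by
    rw [ModuleCat.epi_iff_surjective]
    intro f
    obtain ⟨f, rfl⟩ := Submodule.Quotient.mk_surjective _ f
    exact ⟨Submodule.Quotient.mk f, rfl⟩

/-- An element of `Ext` is killed by scalars that kill the first argument. -/
lemma smul_ext_eq_zero {N : ModuleCat.{u} R} {n : ℕ} (e : Ext (ModuleCat.of R (R ⧸ B)) N n)
    (hy : y ∈ B) : y • e = 0 := by
  have h0 : y • 𝟙 (ModuleCat.of R (R ⧸ B)) = 0 := by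
    ext : 1
    refine Submodule.linearMap_qext _ (LinearMap.ext_ring ?_)
    exact (Submodule.Quotient.mk_eq_zero _).2 (B.mul_mem_right _ hy)
  rw [← e.mk₀_id_comp, ← Ext.smul_comp, ← Ext.mk₀_smul, h0, Ext.mk₀_zero, Ext.zero_comp]

/-- `Ext` from `R ⧸ B` to a module on which some element of `B` acts invertibly is zero. -/
lemma ext_eq_zero_of_isUnit {N : ModuleCat.{u} R} {n : ℕ} (e : Ext (ModuleCat.of R (R ⧸ B)) N n)
    (hy : y ∈ B) (ψ : N ⟶ N) (hψ : y • ψ = 𝟙 N) : e = 0 := by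
  rw [← e.comp_mk₀_id, ← hψ, Ext.mk₀_smul, Ext.comp_smul, ← Ext.smul_comp, smul_ext_eq_zero e hy,
    Ext.zero_comp]

/-- If `y` is a nonzerodivisor modulo `I` and kills `N`, a nonzero class in `Ext (R ⧸ I) N n` gives
one in `Ext (R ⧸ (I + (y))) N (n + 1)`. -/
lemma exists_ext_ne_zero_of_regular {N : ModuleCat.{u} R} (hI : ∀ f, y * f ∈ I ↔ f ∈ I)
    (hB : I ⊔ span {y} = B) (hN : y • 𝟙 N = 0) {n : ℕ} {e : Ext (ModuleCat.of R (R ⧸ I)) N n}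
    (he : e ≠ 0) : ∃ e' : Ext (ModuleCat.of R (R ⧸ B)) N (1 + n), e' ≠ 0 := by
  have hS := quotientColonComplex_shortExact hI hB
  refine ⟨hS.extClass.comp e rfl, fun h => he ?_⟩
  obtain ⟨z, rfl⟩ := Ext.contravariant_sequence_exact₁ hS N e rfl h
  -- Multiplication by `y` can be moved to `N`, where it is zero, so the connecting map is
  -- injective.
  have hz : ∀ z : Ext (ModuleCat.of R (R ⧸ I)) N n,
      (Ext.mk₀ (quotientMulHom hI)).comp z (zero_add n) = 0 := fun z => by
    rw [quotientMulHom_self, Ext.mk₀_smul, Ext.smul_comp, Ext.mk₀_id_comp, ← z.comp_mk₀_id,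
      ← Ext.comp_smul, ← Ext.mk₀_smul, hN, Ext.mk₀_zero, Ext.comp_zero]
  exact hz z

/-- If `y` acts invertibly on `N`, nonzero classes in `Ext (R ⧸ (I : y)) N n` lift to
`Ext (R ⧸ I) N n`. -/
lemma exists_ext_ne_zero_of_colon {N : ModuleCat.{u} R} (hA : ∀ f, y * f ∈ I ↔ f ∈ A)
    (ψ : N ⟶ N) (hψ : y • ψ = 𝟙 N) {n : ℕ} {e : Ext (ModuleCat.of R (R ⧸ A)) N n}
    (he : e ≠ 0) : ∃ e' : Ext (ModuleCat.of R (R ⧸ I)) N n, e' ≠ 0 := by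
  obtain ⟨z, hz⟩ := Ext.contravariant_sequence_exact₁ (quotientColonComplex_shortExact hA rfl) _ e
    rfl (ext_eq_zero_of_isUnit _ (mem_sup_right (mem_span_singleton_self y)) ψ hψ)
  refine ⟨z, ?_⟩
  rintro rfl
  rw [Ext.comp_zero] at hz
  exact he hz.symm

end Ideal

/-! ### The projective dimension for forests -/

namespace SimpleGraph

open CategoryTheory Abelian

variable {V : Type*} {G : SimpleGraph V} {K : Type*} [Field K] {S C : Set V} {x y : V}

lemma X_mul_mem_edgeVarIdeal_iff (hy : y ∉ S) (hG : ∀ w, ¬ G.Adj y w) (f : MvPolynomial V K) :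
    X y * f ∈ G.edgeVarIdeal K S ↔ f ∈ G.edgeVarIdeal K S := by
  classical
  refine ⟨fun h => ?_, fun h => Ideal.mul_mem_left _ _ h⟩
  rw [mem_edgeVarIdeal] at h ⊢
  intro m hm
  have h0 : ∀ v, v ≠ y → (Finsupp.single y 1 + m : V →₀ ℕ) v = m v := fun v hv => by
    simp [hv.symm]
  have hmem : Finsupp.single y 1 + m ∈ (X y * f).support := by
    rw [mem_support_iff, coeff_X_mul]
    exact mem_support_iff.1 hm
  refine (h _ hmem).imp ?_ ?_
  · rintro ⟨v, hv, hne⟩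
    exact ⟨v, hv, by rwa [h0 v (fun h => hy (h ▸ hv))] at hne⟩
  · rintro ⟨v, w, hvw, hv, hw⟩
    rw [h0 v (fun h => hG w (h ▸ hvw))] at hv
    rw [h0 w (fun h => hG v (h ▸ hvw.symm))] at hw
    exact ⟨v, w, hvw, hv, hw⟩

/-- Variables of isolated vertices form a regular sequence modulo the edge ideal, and each raises
the bound by one. -/
lemma hasProjectiveDimensionLT_edgeVarIdeal [Finite V] (hS : ∀ v ∈ S, ∀ w, ¬ G.Adj v w) {n : ℕ}
    (h : HasProjectiveDimensionLE
      (ModuleCat.of (MvPolynomial V K) (MvPolynomial V K ⧸ G.edgeIdeal K)) n) :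
    HasProjectiveDimensionLE
      (ModuleCat.of (MvPolynomial V K) (MvPolynomial V K ⧸ G.edgeVarIdeal K S)) (n + S.ncard) := by
  induction S, Set.toFinite S using Set.Finite.induction_on with
  | empty =>
    rw [edgeVarIdeal_empty]
    simpa using h
  | @insert v S hv hfin ih =>
    rw [Set.ncard_insert_of_notMem hv hfin]
    have := ih fun w hw => hS w (Or.inr hw)
    exact (Ideal.quotientColonComplex_shortExact
      (X_mul_mem_edgeVarIdeal_iff hv (hS v (Or.inl rfl)))
      (edgeVarIdeal_insert G K S v).symm).hasProjectiveDimensionLT_X₃ _ this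
        (@hasProjectiveDimensionLT_of_ge _ _ _ _ _ _ (Nat.le_succ _) this)

/-- Identifies the colon ideal `I(G) : y`: an edge meeting `N(y)` is a multiple of a variable in
`N(y)`. -/
lemma X_mul_mem_edgeIdeal_iff (f : MvPolynomial V K) :
    X y * f ∈ G.edgeIdeal K ↔
      f ∈ (G.isolate (G.neighborSet y)).edgeVarIdeal K (G.neighborSet y) := by
  classical
  rw [← edgeVarIdeal_empty, mem_edgeVarIdeal, mem_edgeVarIdeal]
  have hsupp : (∀ m ∈ (X y * f).support, (∃ v ∈ (∅ : Set V), m v ≠ 0) ∨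
      ∃ v w, G.Adj v w ∧ m v ≠ 0 ∧ m w ≠ 0) ↔ ∀ m ∈ f.support, ∃ v w, G.Adj v w ∧
        (Finsupp.single y 1 + m : V →₀ ℕ) v ≠ 0 ∧ (Finsupp.single y 1 + m : V →₀ ℕ) w ≠ 0 := by
    simp [support_X_mul]
  rw [hsupp]
  refine forall₂_congr fun m _ => ⟨?_, ?_⟩
  · rintro ⟨v, w, hvw, hv, hw⟩
    have h0 : ∀ v, v ≠ y → (Finsupp.single y 1 + m : V →₀ ℕ) v = m v := fun v hv => by
      simp [hv.symm]
    by_cases hvy : v = y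
    · subst hvy
      exact Or.inl ⟨w, hvw, by rwa [h0 w hvw.ne'] at hw⟩
    by_cases hwy : w = y
    · subst hwy
      exact Or.inl ⟨v, hvw.symm, by rwa [h0 v hvw.ne] at hv⟩
    rw [h0 v hvy] at hv
    rw [h0 w hwy] at hw
    by_cases hvN : v ∈ G.neighborSet y
    · exact Or.inl ⟨v, hvN, hv⟩
    by_cases hwN : w ∈ G.neighborSet y
    · exact Or.inl ⟨w, hwN, hw⟩
    exact Or.inr ⟨v, w, ⟨hvw, hvN, hwN⟩, hv, hw⟩
  · have h0 : ∀ v, m v ≠ 0 → (Finsupp.single y 1 + m : V →₀ ℕ) v ≠ 0 := fun v hv => by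
      rw [Finsupp.add_apply]
      omega
    rintro (⟨v, hv, hm⟩ | ⟨v, w, hvw, hv, hw⟩)
    · exact ⟨y, v, hv, by simp, h0 v hm⟩
    · exact ⟨v, w, hvw.1, h0 v hv, h0 w hw⟩

variable (G K) in
lemma edgeIdeal_sup_span_X (y : V) :
    G.edgeIdeal K ⊔ Ideal.span {X y} = (G.isolate {y}).edgeVarIdeal K {y} := by
  rw [edgeVarIdeal, Set.image_singleton]
  refine le_antisymm (sup_le (edgeIdeal_le_iff.2 fun v w hvw => ?_) le_sup_right)
    (sup_le_sup_right (edgeIdeal_le_iff.2 fun _ _ hvw =>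
      X_mul_X_mem_edgeIdeal (isolate_le hvw)) _)
  by_cases hv : v = y
  · exact Ideal.mem_sup_right (Ideal.mul_mem_right _ _ (hv ▸ Ideal.mem_span_singleton_self _))
  by_cases hw : w = y
  · exact Ideal.mem_sup_right (Ideal.mul_mem_left _ _ (hw ▸ Ideal.mem_span_singleton_self _))
  exact Ideal.mem_sup_left (X_mul_X_mem_edgeIdeal ⟨hvw, hv, hw⟩)

variable (K) in
/-- The projective dimension of the quotient by the edge ideal of a forest is at most the
cardinality of some minimal vertex cover. -/
theorem IsAcyclic.exists_minimal_isVertexCover_hasProjectiveDimensionLE [Finite V]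
    (hac : G.IsAcyclic) : ∃ C, Minimal G.IsVertexCover C ∧ HasProjectiveDimensionLE
      (ModuleCat.of (MvPolynomial V K) (MvPolynomial V K ⧸ G.edgeIdeal K)) C.ncard := by
  induction G using WellFoundedLT.induction with
  | ind G ih =>
  rcases eq_or_ne G ⊥ with rfl | hG
  · refine ⟨∅, minimal_isVertexCover_iff.2 ⟨isVertexCover_bot _, by simp⟩, ?_⟩
    have h : (⊥ : SimpleGraph V).edgeIdeal K = ⊥ :=
      le_bot_iff.1 (edgeIdeal_le_iff.2 fun v w hvw => hvw.elim)
    rw [h, Set.ncard_empty, ← projective_iff_hasProjectiveDimensionLE_zero,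
      ← IsProjective.iff_projective]
    exact Module.Projective.of_equiv (Submodule.quotEquivOfEqBot _ rfl).symm
  · obtain ⟨x, y, hyx, hx⟩ := hac.exists_leaf hG
    obtain ⟨C₁, hC₁, hJ⟩ := ih (G.isolate {y}) (isolate_lt hyx rfl) (hac.anti isolate_le)
    obtain ⟨C₂, hC₂, hL⟩ := ih (G.isolate (G.neighborSet y)) (isolate_lt hyx.symm hyx)
      (hac.anti isolate_le)
    have hxC := not_mem_of_minimal_isVertexCover_isolate_of_leaf hx hC₁
    have hmin₁ := minimal_isVertexCover_insert hC₁ hyx hxC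
    obtain ⟨hmin₂, hdisj⟩ := minimal_isVertexCover_union_neighborSet hC₂
    have hcard₁ := Set.ncard_insert_of_notMem
      (not_mem_of_minimal_isVertexCover_isolate hC₁ rfl) (Set.toFinite C₁)
    have hcard₂ := Set.ncard_union_eq hdisj (Set.toFinite _) (Set.toFinite _)
    have hJ' := hasProjectiveDimensionLT_edgeVarIdeal (G := G.isolate {y}) (S := {y}) (by
      rintro v rfl w hw
      exact (isolate_adj.1 hw).2.1 rfl) hJ
    have hL' := hasProjectiveDimensionLT_edgeVarIdeal (G := G.isolate (G.neighborSet y))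
      (S := G.neighborSet y)
      (fun v hv w hw => (isolate_adj.1 hw).2.1 hv) hL
    rw [Set.ncard_singleton, ← hcard₁] at hJ'
    rw [← hcard₂] at hL'
    have hS := Ideal.quotientColonComplex_shortExact (X_mul_mem_edgeIdeal_iff (G := G) (y := y))
      (edgeIdeal_sup_span_X G K y)
    rcases le_total (insert y C₁).ncard (C₂ ∪ G.neighborSet y).ncard with hle | hle
    · exact ⟨_, hmin₂, hS.hasProjectiveDimensionLT_X₂ _ hL'
        (@hasProjectiveDimensionLT_of_ge _ _ _ _ _ _ (Nat.succ_le_succ hle) hJ')⟩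
    · exact ⟨_, hmin₁, hS.hasProjectiveDimensionLT_X₂ _
        (@hasProjectiveDimensionLT_of_ge _ _ _ _ _ _ (Nat.succ_le_succ hle) hL') hJ'⟩

lemma exists_ext_span_X_image_ne_zero [Finite V] {N : ModuleCat (MvPolynomial V K)} [Nontrivial N]
    (hN : ∀ v ∈ C, (X v : MvPolynomial V K) • 𝟙 N = 0) :
    ∃ e : Ext (ModuleCat.of (MvPolynomial V K)
      (MvPolynomial V K ⧸ Ideal.span (X '' C : Set (MvPolynomial V K)))) N C.ncard, e ≠ 0 := by
  induction C, Set.toFinite C using Set.Finite.induction_on with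
  | empty =>
    obtain ⟨n, hn⟩ := exists_ne (0 : N)
    rw [Set.ncard_empty, Set.image_empty, Ideal.span_empty]
    let φ := ModuleCat.ofHom (Submodule.liftQ (⊥ : Ideal (MvPolynomial V K))
      (LinearMap.toSpanSingleton _ N n) bot_le)
    refine ⟨Ext.mk₀ φ, fun h => hn ?_⟩
    rw [← Ext.mk₀_zero, (Ext.mk₀_bijective _ _).1.eq_iff] at h
    have h1 : φ.hom (Submodule.Quotient.mk 1) = 0 := by rw [h]; rfl
    exact (one_smul _ n).symm.trans h1
  | @insert v C hv hfin ih =>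
    obtain ⟨e, he⟩ := ih fun w hw => hN w (Or.inr hw)
    rw [Set.ncard_insert_of_notMem hv hfin, add_comm]
    have := isPrime_span_X_image K C
    refine Ideal.exists_ext_ne_zero_of_regular (fun f => ?_) ?_ (hN v (Or.inl rfl)) he
    · refine ⟨fun h => (this.mem_or_mem h).resolve_left fun h => hv (X_mem_span_X_image.1 h),
        fun h => Ideal.mul_mem_left _ _ h⟩
    · rw [Set.image_insert_eq, Ideal.span_insert, sup_comm]

/-- The cardinality of a minimal vertex cover is a lower bound for the projective dimension of the
quotient by the edge ideal. -/
theorem not_hasProjectiveDimensionLT_of_minimal_isVertexCover [Finite V]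
    (hC : Minimal G.IsVertexCover C) : ¬ HasProjectiveDimensionLT
      (ModuleCat.of (MvPolynomial V K) (MvPolynomial V K ⧸ G.edgeIdeal K)) C.ncard := by
  classical
  intro hpd
  set P := Ideal.span (X '' C : Set (MvPolynomial V K)) with hP
  have hprime : P.IsPrime := isPrime_span_X_image K C
  -- On the residue field `P` acts as zero and `y ∉ P` acts invertibly, so no localization of `Ext`
  -- is needed.
  let N := ModuleCat.of (MvPolynomial V K) P.ResidueField
  set y : MvPolynomial V K := ∏ v ∈ (Set.toFinite Cᶜ).toFinset, X v with hy
  have hyP : y ∉ P := by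
    rw [hy, hprime.prod_mem_iff]
    rintro ⟨v, hv, hvP⟩
    exact ((Set.Finite.mem_toFinset _).1 hv) (X_mem_span_X_image.1 hvP)
  have hcolon : ∀ f, y * f ∈ G.edgeIdeal K ↔ f ∈ P := by
    refine fun f => ⟨fun h => (hprime.mem_or_mem (edgeIdeal_le_span_X_image hC.prop h)).resolve_left
      hyP, fun h => ?_⟩
    suffices h' : P ≤ Submodule.comap (LinearMap.mulLeft (MvPolynomial V K) y) (G.edgeIdeal K) from
      h' h
    refine Ideal.span_le.2 ?_
    rintro _ ⟨v, hv, rfl⟩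
    -- By minimality `v` has a neighbour `w` outside `C`, and `X w` divides `y`.
    obtain ⟨w, hvw, hw⟩ := (minimal_isVertexCover_iff.1 hC).2 v hv
    obtain ⟨c, hc⟩ := Finset.dvd_prod_of_mem (fun v => (X v : MvPolynomial V K))
      ((Set.Finite.mem_toFinset (Set.toFinite Cᶜ)).2 hw)
    change y * X v ∈ G.edgeIdeal K
    rw [hy, hc, show X w * c * X v = c * (X v * X w) by ring]
    exact Ideal.mul_mem_left _ _ (X_mul_X_mem_edgeIdeal hvw)
  have hN : ∀ v ∈ C, (X v : MvPolynomial V K) • 𝟙 N = 0 := by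
    intro v hv
    ext z
    change (X v : MvPolynomial V K) • (z : P.ResidueField) = 0
    rw [Algebra.smul_def, Ideal.algebraMap_residueField_eq_zero.2 (X_mem_span_X_image.2 hv),
      zero_mul]
  let ψ : N ⟶ N := ModuleCat.ofHom
    (LinearMap.mulLeft (MvPolynomial V K) (algebraMap _ P.ResidueField y)⁻¹)
  have hψ : y • ψ = 𝟙 N := by
    ext z
    change y • ((algebraMap _ P.ResidueField y)⁻¹ * (z : P.ResidueField)) = z
    rw [Algebra.smul_def, mul_inv_cancel_left₀]
    exact fun h => hyP (Ideal.algebraMap_residueField_eq_zero.1 h)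
  obtain ⟨e, he⟩ := exists_ext_span_X_image_ne_zero hN
  obtain ⟨e', he'⟩ := Ideal.exists_ext_ne_zero_of_colon hcolon ψ hψ he
  exact he' (e'.eq_zero_of_hasProjectiveDimensionLT _ le_rfl)

/-- The projective dimension of the quotient by the edge ideal of a forest is its big height. -/
theorem IsAcyclic.projectiveDimension_eq [Finite V] (hac : G.IsAcyclic) :
    projectiveDimension (ModuleCat.of (MvPolynomial V K) (MvPolynomial V K ⧸ G.edgeIdeal K)) =
      ((G.edgeIdeal K).bigHeight : WithBot ℕ∞) := by
  obtain ⟨⟨C, hC, hcard⟩, hmax⟩ := isGreatest_bigHeight_edgeIdeal G K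
  obtain ⟨D, hD, hpd⟩ := hac.exists_minimal_isVertexCover_hasProjectiveDimensionLE K
  refine le_antisymm (((projectiveDimension_le_iff _ _).2 hpd).trans ?_) ?_
  · have := hmax ⟨D, hD, rfl⟩
    rw [← Set.Finite.cast_ncard_eq (Set.toFinite D)] at this
    exact_mod_cast this
  · rw [← hcard, ← Set.Finite.cast_ncard_eq (Set.toFinite C)]
    exact (projectiveDimension_ge_iff _ _).2
      (not_hasProjectiveDimensionLT_of_minimal_isVertexCover hC)

end SimpleGraph
theorem theorem4p7 {V : Type*} [Finite V] (G : SimpleGraph V) (K : Type*) [Field K] :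
    -- big height as the largest size of a minimal vertex cover
    IsGreatest {k : ℕ∞ | ∃ C : Set V, Minimal G.IsVertexCover C ∧ C.encard = k}
      (G.edgeIdeal K).bigHeight ∧
    -- the bound for graphs with pairwise vertex-disjoint cycles
    (G.HasPairwiseDisjointCycles →
      (G.edgeIdeal K).arithmeticalRank ≤ (G.edgeIdeal K).bigHeight + G.cycleSubgraphs.encard) ∧
    -- the equalities for forests
    (G.IsAcyclic →
      (G.edgeIdeal K).arithmeticalRank = (G.edgeIdeal K).bigHeight ∧
      CategoryTheory.projectiveDimension
          (ModuleCat.of (MvPolynomial V K) (MvPolynomial V K ⧸ G.edgeIdeal K)) =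
        ((G.edgeIdeal K).bigHeight : WithBot ℕ∞)) := by
  refine ⟨G.isGreatest_bigHeight_edgeIdeal K, fun _ => G.arithmeticalRank_edgeIdeal_le K,
    fun hac => ⟨le_antisymm ?_ (Ideal.bigHeight_le_arithmeticalRank _), hac.projectiveDimension_eq⟩⟩
  have h := G.arithmeticalRank_edgeIdeal_le K
  rwa [hac.cycleSubgraphs_eq_empty, Set.encard_empty, add_zero] at h
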